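/- Let $\mathbb K$ be any field and let $\mathcal C\subseteq\mathbb K^n$ be an $[n,k,d]$ linear code with $d\ge 3$, i.e. a $k$-dimensional subspace in which the smallest number of non-zero entries of a non-zero codeword is $d$. Let $G=(a_{ij})$ be a generating matrix of $\mathcal C$, i.e. a $k\times n$ matrix whose rows form a basis of $\mathcal C$, and let $w=(w_1,\dots,w_n)\in\mathbb K^n$ have exactly $m$ non-zero entries, where $1\le m\le\lfloor (d-1)/2\rfloor$. In $S=\mathbb K[x_1,\dots,x_k,T]$ put $$L_j=a_{1j}x_1+\cdots+a_{kj}x_k+w_jT\qquad(1\le j\le n),$$ the linear forms given by the columns of the matrix $G^w$ obtained from $G$ by adding the row $w$, and let $$I_{m+1}(\mathcal C^w)=\langle L_{j_1}\cdots L_{j_{m+1}} : 1\le j_1<\cdots<j_{m+1}\le n\rangle\subseteq S .$$ Then the Castelnuovo–Mumford regularity of this ideal is $$\operatorname{reg}(I_{m+1}(\mathcal C^w))=m+1 ;$$ equivalently, $I_{m+1}(\mathcal C^w)$ has a linear graded free resolution. Here, for a homogeneous ideal $I\neq 0$ of $S$ with minimal graded free resolution $0\to F_t\to\cdots\to F_0\to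 I\to 0$, $F_j=\bigoplus_{i} S(-b_{i,j})$, one puts $\operatorname{reg}(I)=\max_{i,j}(b_{i,j}-j)$; and $I_{m+1}(\mathcal C^w)$ has a linear graded free resolution if $b_{i,j}=m+1+j$ for all $i,j$ in such a resolution. -/

import Mathlib

/-! ### Linear codes -/

/-- `C` is an `[n, k, d]` linear code over `K`: a `k`-dimensional subspace of `K^n` for which `d` is
the smallest number of non-zero entries of a non-zero codeword. -/
structure IsLinearCode {K : Type*} [Field K] [DecidableEq K] (n k d : ℕ)
    (C : Submodule K (Fin n → K)) : Prop where
  finrank_eq : Module.finrank K C = k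
  isLeast_weight : IsLeast {t : ℕ | ∃ c ∈ C, c ≠ 0 ∧ hammingNorm c = t} d

/-- `G` is a generating matrix of `C`: its rows form a basis of `C`. -/
structure IsGeneratingMatrix {K : Type*} [Field K] {n k : ℕ}
    (G : Matrix (Fin k) (Fin n) K) (C : Submodule K (Fin n → K)) : Prop where
  linearIndependent : LinearIndependent K G.row
  span_eq : Submodule.span K (Set.range G.row) = C

/-- The augmented matrix `G^w`: the rows of `G`, followed by the extra row `w`. -/
def augmentedMatrix {K : Type*} [Field K] {n k : ℕ} (G : Matrix (Fin k) (Fin n) K)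
    (w : Fin n → K) : Matrix (Fin k ⊕ Unit) (Fin n) K :=
  Matrix.fromRows G (Matrix.replicateRow Unit w)

/-- The linear form `∑ i, A i j * X i` attached to the `j`-th column of `A`. -/
noncomputable def columnForm {K : Type*} [Field K] {σ : Type*} [Fintype σ] {n : ℕ}
    (A : Matrix σ (Fin n) K) (j : Fin n) : MvPolynomial σ K :=
  ∑ i, MvPolynomial.C (A i j) * MvPolynomial.X i

/-- The ideal generated by all products of `s` of the column forms of `A`, taken at `s` pairwise
different column positions. -/
noncomputable def productIdeal {K : Type*} [Field K] {σ : Type*} [Fintype σ] {n : ℕ}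
    (A : Matrix σ (Fin n) K) (s : ℕ) : Ideal (MvPolynomial σ K) :=
  Ideal.span {p | ∃ J : Finset (Fin n), J.card = s ∧ p = ∏ j ∈ J, columnForm A j}

/-! ### Graded free resolutions and regularity -/

/-- The degree `e` part of the polynomial ring `S`, for `e : ℤ` (zero for negative `e`). -/
noncomputable def polyPart (σ K : Type*) [Field K] (e : ℤ) : Submodule K (MvPolynomial σ K) :=
  if 0 ≤ e then MvPolynomial.homogeneousSubmodule σ K e.toNat else ⊥

/-- The degree `e` part of the graded free module `⨁ i, S(-b i)`. Recall `S(-b)_e = S_{e - b}`. -/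
noncomputable def twistedPart {σ K ι : Type*} [Field K] (b : ι → ℤ) (e : ℤ) :
    Submodule K (ι → MvPolynomial σ K) :=
  Submodule.pi Set.univ (fun i => polyPart σ K (e - b i))

/-- A finite graded free resolution
`0 → F_t → ⋯ → F_1 → F_0 → I → 0` with `F_j = ⨁ i, S(-shift j i)` of finite rank and all maps
homogeneous of degree `0`. -/
structure GradedFreeResolution {σ K : Type*} [Field K] (I : Ideal (MvPolynomial σ K)) where
  /-- the rank of `F_j` -/
  rank : ℕ → ℕ
  /-- the degrees of the basis elements of `F_j` -/
  shift : (j : ℕ) → Fin (rank j) → ℤ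
  /-- the differential `F_{j+1} → F_j` -/
  diff : (j : ℕ) →
    (Fin (rank (j + 1)) → MvPolynomial σ K) →ₗ[MvPolynomial σ K] (Fin (rank j) → MvPolynomial σ K)
  /-- the augmentation `F_0 → I ⊆ S` -/
  aug : (Fin (rank 0) → MvPolynomial σ K) →ₗ[MvPolynomial σ K] MvPolynomial σ K
  finite_length : ∃ t : ℕ, ∀ j, t < j → rank j = 0
  diff_graded : ∀ (j : ℕ) (e : ℤ), ∀ v ∈ twistedPart (shift (j + 1)) e,
    diff j v ∈ twistedPart (shift j) e
  aug_graded : ∀ e : ℤ, ∀ v ∈ twistedPart (shift 0) e, aug v ∈ polyPart σ K e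
  range_aug : LinearMap.range aug = I
  exact_aug : Function.Exact (diff 0) aug
  exact_diff : ∀ j : ℕ, Function.Exact (diff (j + 1)) (diff j)

/-- The resolution is minimal: the image of `F_{j+1} → F_j` lies in `𝔪 F_j`, where `𝔪` is the
ideal generated by the variables. -/
def GradedFreeResolution.IsMinimal {σ K : Type*} [Field K] {I : Ideal (MvPolynomial σ K)}
    (F : GradedFreeResolution I) : Prop :=
  ∀ (j : ℕ) (v : Fin (F.rank (j + 1)) → MvPolynomial σ K) (i : Fin (F.rank j)),
    F.diff j v i ∈ Ideal.span (Set.range (MvPolynomial.X : σ → MvPolynomial σ K))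

/-- `reg I = r`: the ideal `I` has a minimal graded free resolution, and for each such resolution
the maximum of the numbers `b_{i,j} - j` exists and is `r`. -/
def HasRegularity {σ K : Type*} [Field K] (I : Ideal (MvPolynomial σ K)) (r : ℤ) : Prop :=
  (∃ F : GradedFreeResolution I, F.IsMinimal) ∧
    ∀ F : GradedFreeResolution I, F.IsMinimal →
      IsGreatest {x : ℤ | ∃ (j : ℕ) (i : Fin (F.rank j)), x = F.shift j i - j} r

/-- `I` has a linear graded free resolution with generators in degree `a`, i.e. a minimal graded
free resolution with `F_j = S(-(a + j))^{rank j}` for all `j`. -/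
def HasLinearResolution {σ K : Type*} [Field K] (I : Ideal (MvPolynomial σ K)) (a : ℤ) : Prop :=
  ∃ F : GradedFreeResolution I, F.IsMinimal ∧
    ∀ (j : ℕ) (i : Fin (F.rank j)), F.shift j i = a + j

/-! ### Homogeneous components with integer degrees -/

section PolyPart

variable {σ K : Type*} [Field K]

/-! Write `P` for the ideal of the row variables and `𝔪` for that of all variables, `T` included.
The weight bounds force the ideal of products to be the monomial ideal `P * 𝔪 ^ m`
(`productIdeal_augmentedMatrix_eq`). Each product of `m + 1` forms has a factor free of `T`, because
`w` has only `m` non-zero entries. Conversely, if `|J| ≤ m` and `J` meets the zeros of `w`, the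
columns of `G^w` outside `J` span: otherwise some non-zero row combination would be supported in
`J`, which `2 * m < d` excludes. Hence every variable multiplying `∏ j ∈ J, L_j` can be traded for
forms outside `J` until there are `m + 1` factors.

The monomial ideal is resolved by mapping cones. If `A ≤ B`, `x` is a linear form that is a
nonzerodivisor modulo `A`, and `A`, `B` have linear resolutions in degrees `a + 1`, `a`, then `A + x
B` has one in degree `a + 1` (`HasLinearFreeResolution.add_mul`). Splitting off one variable at a
time gives the powers of `P`, then `P * 𝔪 ^ m`.

Finally, comparison of resolutions shows that one linear resolution makes every minimal one linear,
which determines the regularity. -/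

theorem mem_polyPart_iff {e : ℤ} {p : MvPolynomial σ K} :
    p ∈ polyPart σ K e ↔ ∀ u, p.coeff u ≠ 0 → (u.degree : ℤ) = e := by
  unfold polyPart
  split_ifs with he
  · rw [MvPolynomial.mem_homogeneousSubmodule]
    constructor
    · intro h u hu
      have := h.degree_eq_sum_deg_support (MvPolynomial.mem_support_iff.2 hu)
      have h2 : u.degree = ∑ i ∈ u.support, u i := rfl
      omega
    · intro h u hu
      have := h u hu
      rw [show Finsupp.weight 1 u = u.degree from
        (DFunLike.congr_fun Finsupp.degree_eq_weight_one u).symm]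
      omega
  · rw [Submodule.mem_bot]
    constructor
    · rintro rfl u hu
      simp at hu
    · intro h
      ext u
      by_contra hu
      have := h u (by simpa using hu)
      omega

/-- The projection of a polynomial onto its part of degree `e`. -/
noncomputable def polyProj (e : ℤ) : MvPolynomial σ K →ₗ[K] MvPolynomial σ K :=
  if 0 ≤ e then MvPolynomial.homogeneousComponent e.toNat else 0

theorem coeff_polyProj (e : ℤ) (p : MvPolynomial σ K) (u : σ →₀ ℕ) :
    (polyProj e p).coeff u = if (u.degree : ℤ) = e then p.coeff u else 0 := by
  unfold polyProj
  split_ifs with h1 h2 h2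
  · rw [MvPolynomial.coeff_homogeneousComponent, if_pos (by omega)]
  · rw [MvPolynomial.coeff_homogeneousComponent, if_neg (by omega)]
  · omega
  · simp

theorem polyProj_mem (e : ℤ) (p : MvPolynomial σ K) : polyProj e p ∈ polyPart σ K e := by
  rw [mem_polyPart_iff]
  intro u hu
  by_contra h
  exact hu (by rw [coeff_polyProj, if_neg h])

theorem polyProj_of_mem {e : ℤ} {p : MvPolynomial σ K} (hp : p ∈ polyPart σ K e) :
    polyProj e p = p := by
  rw [mem_polyPart_iff] at hp
  ext u
  rw [coeff_polyProj]
  split_ifs with h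
  · rfl
  · by_contra h2
    exact h (hp u (Ne.symm h2))

theorem polyProj_mul {s : ℤ} (t : ℤ) (p : MvPolynomial σ K) {q : MvPolynomial σ K}
    (hq : q ∈ polyPart σ K s) : polyProj (t + s) (p * q) = polyProj t p * q := by
  classical
  rw [mem_polyPart_iff] at hq
  ext u
  rw [coeff_polyProj, MvPolynomial.coeff_mul, MvPolynomial.coeff_mul]
  split_ifs with hu
  all_goals
    first
    | refine Finset.sum_congr rfl fun x hx => ?_
    | refine (Finset.sum_eq_zero fun x hx => ?_).symm
    rw [coeff_polyProj]
    by_cases hx2 : q.coeff x.2 = 0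
    · simp [hx2]
    · have h1 := hq _ hx2
      have h2 := congrArg Finsupp.degree (Finset.HasAntidiagonal.mem_antidiagonal.1 hx)
      rw [map_add] at h2
      first
      | rw [if_pos (by omega)]
      | rw [if_neg (by omega), zero_mul]

theorem mul_mem_polyPart {s t : ℤ} {p q : MvPolynomial σ K} (hp : p ∈ polyPart σ K t)
    (hq : q ∈ polyPart σ K s) : p * q ∈ polyPart σ K (t + s) := by
  have h := polyProj_mem (t + s) (p * q)
  rwa [polyProj_mul t p hq, polyProj_of_mem hp] at h

theorem one_mem_polyPart : (1 : MvPolynomial σ K) ∈ polyPart σ K 0 := by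
  rw [polyPart, if_pos le_rfl]
  exact MvPolynomial.isHomogeneous_one σ K

theorem mem_polyPart_natCast {a : ℕ} {p : MvPolynomial σ K} :
    p ∈ polyPart σ K a ↔ p.IsHomogeneous a := by
  simp [polyPart]

theorem mem_twistedPart_iff {ι : Type*} {b : ι → ℤ} {e : ℤ} {v : ι → MvPolynomial σ K} :
    v ∈ twistedPart b e ↔ ∀ i, v i ∈ polyPart σ K (e - b i) := by
  simp [twistedPart, Submodule.mem_pi]

theorem mem_ideal_vars_of_mem_polyPart {e : ℤ} (he : e ≠ 0) {p : MvPolynomial σ K}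
    (hp : p ∈ polyPart σ K e) :
    p ∈ Ideal.span (Set.range (MvPolynomial.X : σ → MvPolynomial σ K)) := by
  rw [← Set.image_univ, MvPolynomial.mem_ideal_span_X_image]
  intro u hu
  have := mem_polyPart_iff.1 hp u (MvPolynomial.mem_support_iff.1 hu)
  have hu0 : u ≠ 0 := by
    rintro rfl
    simp at this
    omega
  obtain ⟨i, hi⟩ := Finsupp.ne_iff.1 hu0
  exact ⟨i, Set.mem_univ _, by simpa using hi⟩

theorem one_notMem_ideal_vars :
    (1 : MvPolynomial σ K) ∉ Ideal.span (Set.range (MvPolynomial.X : σ → MvPolynomial σ K)) := by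
  rw [← Set.image_univ, MvPolynomial.mem_ideal_span_X_image]
  intro h
  obtain ⟨i, -, hi⟩ := h 0 (by simp)
  simp at hi

end PolyPart

/-! ### Graded maps between graded free modules -/

section GradedMaps

variable {σ K : Type*} [Field K]

theorem single_mem_twistedPart {ι : Type*} [DecidableEq ι] (b : ι → ℤ) (i : ι) :
    Pi.single i (1 : MvPolynomial σ K) ∈ twistedPart b (b i) := by
  rw [mem_twistedPart_iff]
  intro i'
  rcases eq_or_ne i' i with rfl | h
  · simpa using one_mem_polyPart
  · simp [h]

theorem map_eq_sum_single {R ι M : Type*} [CommSemiring R] [Fintype ι] [DecidableEq ι]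
    [AddCommMonoid M] [Module R M] (D : (ι → R) →ₗ[R] M) (v : ι → R) :
    D v = ∑ i, v i • D (Pi.single i 1) := by
  rw [LinearMap.pi_apply_eq_sum_univ D v]
  refine Finset.sum_congr rfl fun i _ => ?_
  congr 2
  ext j
  simp [Pi.single_apply, eq_comm]

/-- A graded map commutes with projection to a degree, so a preimage of a homogeneous element can be
replaced by its homogeneous part. The next two lemmas rest on this. -/
theorem sum_polyProj_apply_single {ι : Type*} [Fintype ι] [DecidableEq ι] {b : ι → ℤ} {c : ℤ}
    (D : (ι → MvPolynomial σ K) →ₗ[MvPolynomial σ K] MvPolynomial σ K)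
    (hD : ∀ i, D (Pi.single i 1) ∈ polyPart σ K (b i - c)) (e : ℤ) (v : ι → MvPolynomial σ K) :
    D (fun i => polyProj (e - b i) (v i)) = polyProj (e - c) (D v) := by
  have key : ∀ v, D v = ∑ i, v i * D (Pi.single i 1) := map_eq_sum_single D
  rw [key, key v, map_sum]
  refine Finset.sum_congr rfl fun i _ => ?_
  rw [← polyProj_mul _ _ (hD i)]
  congr 2
  ring

theorem exists_mem_twistedPart_of_aug {ι : Type*} [Fintype ι] {b : ι → ℤ}
    (D : (ι → MvPolynomial σ K) →ₗ[MvPolynomial σ K] MvPolynomial σ K)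
    (hD : ∀ e, ∀ v ∈ twistedPart b e, D v ∈ polyPart σ K e) {e : ℤ}
    {y : MvPolynomial σ K} (hy : y ∈ polyPart σ K e) (hyD : y ∈ LinearMap.range D) :
    ∃ v ∈ twistedPart b e, D v = y := by
  classical
  obtain ⟨v, rfl⟩ := hyD
  refine ⟨fun i => polyProj (e - b i) (v i),
    mem_twistedPart_iff.2 fun i => polyProj_mem _ _, ?_⟩
  rw [sum_polyProj_apply_single (c := 0) D (fun i => ?_) e v, sub_zero, polyProj_of_mem hy]
  rw [sub_zero]
  exact hD _ _ (single_mem_twistedPart b i)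

theorem exists_mem_twistedPart_of_diff {ι κ : Type*} [Fintype ι] {b : ι → ℤ} {c : κ → ℤ}
    (D : (ι → MvPolynomial σ K) →ₗ[MvPolynomial σ K] (κ → MvPolynomial σ K))
    (hD : ∀ e, ∀ v ∈ twistedPart b e, D v ∈ twistedPart c e) {e : ℤ}
    {y : κ → MvPolynomial σ K} (hy : y ∈ twistedPart c e) (hyD : y ∈ LinearMap.range D) :
    ∃ v ∈ twistedPart b e, D v = y := by
  classical
  obtain ⟨v, rfl⟩ := hyD
  refine ⟨fun i => polyProj (e - b i) (v i),
    mem_twistedPart_iff.2 fun i => polyProj_mem _ _, ?_⟩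
  ext1 k
  have := sum_polyProj_apply_single (c := c k) ((LinearMap.proj k).comp D)
    (fun i => mem_twistedPart_iff.1 (hD _ _ (single_mem_twistedPart b i)) k) e v
  simp only [LinearMap.comp_apply, LinearMap.proj_apply] at this
  rw [this, polyProj_of_mem (mem_twistedPart_iff.1 hy k)]

/-- A choice of homogeneous images of the basis elements defines a graded map. -/
theorem linearCombination_mem_twistedPart {ι κ : Type*} [Fintype ι] {b : ι → ℤ} {c : κ → ℤ}
    {y : ι → κ → MvPolynomial σ K} (hy : ∀ i, y i ∈ twistedPart c (b i)) {e : ℤ}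
    {v : ι → MvPolynomial σ K} (hv : v ∈ twistedPart b e) :
    Fintype.linearCombination (MvPolynomial σ K) y v ∈ twistedPart c e := by
  rw [mem_twistedPart_iff] at hv ⊢
  intro k
  rw [Fintype.linearCombination_apply, Finset.sum_apply]
  refine Submodule.sum_mem _ fun i _ => ?_
  have := mul_mem_polyPart (hv i) (mem_twistedPart_iff.1 (hy i) k)
  simpa using this

/-- Lifting a map out of a graded free module through `D`, when homogeneous lifts exist on the
basis elements. -/
theorem exists_graded_map_lift {ι κ M : Type*} [Fintype ι] [DecidableEq ι]
    [AddCommGroup M] [Module (MvPolynomial σ K) M]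
    {b : ι → ℤ} {c : κ → ℤ} (D : (κ → MvPolynomial σ K) →ₗ[MvPolynomial σ K] M)
    (h : (ι → MvPolynomial σ K) →ₗ[MvPolynomial σ K] M)
    (hl : ∀ i, ∃ v ∈ twistedPart c (b i), D v = h (Pi.single i 1)) :
    ∃ f : (ι → MvPolynomial σ K) →ₗ[MvPolynomial σ K] (κ → MvPolynomial σ K),
      (∀ e, ∀ v ∈ twistedPart b e, f v ∈ twistedPart c e) ∧ ∀ v, D (f v) = h v := by
  choose y hy hyD using hl
  refine ⟨Fintype.linearCombination _ y, fun e v hv => linearCombination_mem_twistedPart hy hv, ?_⟩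
  intro v
  rw [Fintype.linearCombination_apply, map_sum, map_eq_sum_single h v]
  exact Finset.sum_congr rfl fun i _ => by rw [map_smul, hyD]

/-- Lifting an arbitrary map out of a free module through a map whose range contains its values. -/
theorem exists_map_lift {R ι M N : Type*} [CommRing R] [Fintype ι]
    [AddCommGroup M] [Module R M] [AddCommGroup N] [Module R N]
    (D : N →ₗ[R] M) (h : (ι → R) →ₗ[R] M) (hl : ∀ v, h v ∈ LinearMap.range D) :
    ∃ f : (ι → R) →ₗ[R] N, ∀ v, D (f v) = h v := by
  obtain ⟨f, hf⟩ := Module.projective_lifting_property D.rangeRestrict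
    (h.codRestrict (LinearMap.range D) hl) D.surjective_rangeRestrict
  exact ⟨f, fun v => congrArg Subtype.val (LinearMap.congr_fun hf v)⟩

end GradedMaps

/-- Dependent recursive choice along `ℕ`, subject to an invariant. -/
theorem exists_seq_of_step {X : ℕ → Type*} (Q : ∀ j, X j → Prop) (R : ∀ j, X j → X (j + 1) → Prop)
    (P : X 0 → Prop) (h0 : ∃ x, Q 0 x ∧ P x)
    (step : ∀ j x, Q j x → ∃ y, Q (j + 1) y ∧ R j x y) :
    ∃ f : ∀ j, X j, P (f 0) ∧ (∀ j, Q j (f j)) ∧ ∀ j, R j (f j) (f (j + 1)) := by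
  choose next hQ hR using step
  let g : ∀ j, {x : X j // Q j x} := fun j =>
    Nat.rec ⟨h0.choose, h0.choose_spec.1⟩ (fun j x => ⟨next j x.1 x.2, hQ j x.1 x.2⟩) j
  exact ⟨fun j => (g j).1, h0.choose_spec.2, fun j => (g j).2, fun j => hR j (g j).1 (g j).2⟩

/-! ### Comparison of graded free resolutions -/

namespace GradedFreeResolution

variable {σ K : Type*} [Field K] {I A B : Ideal (MvPolynomial σ K)}

theorem diff_mem_range (F : GradedFreeResolution I) {j : ℕ}
    {v : Fin (F.rank (j + 1)) → MvPolynomial σ K} (hv : F.diff j v = 0) :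
    v ∈ LinearMap.range (F.diff (j + 1)) :=
  (F.exact_diff j v).1 hv

theorem diff_diff (F : GradedFreeResolution I) (j : ℕ)
    (v : Fin (F.rank (j + 2)) → MvPolynomial σ K) : F.diff j (F.diff (j + 1) v) = 0 :=
  (F.exact_diff j _).2 ⟨v, rfl⟩

theorem aug_diff (F : GradedFreeResolution I) (v : Fin (F.rank 1) → MvPolynomial σ K) :
    F.aug (F.diff 0 v) = 0 :=
  (F.exact_aug _).2 ⟨v, rfl⟩

/-- The inclusion of an ideal `A` into an ideal `B` lifts to a graded map of resolutions. -/
theorem exists_lift (F : GradedFreeResolution A) (G : GradedFreeResolution B) (hAB : A ≤ B) :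
    ∃ f : ∀ j, (Fin (F.rank j) → MvPolynomial σ K) →ₗ[MvPolynomial σ K]
        (Fin (G.rank j) → MvPolynomial σ K),
      (∀ v, G.aug (f 0 v) = F.aug v) ∧
      (∀ j e, ∀ v ∈ twistedPart (F.shift j) e, f j v ∈ twistedPart (G.shift j) e) ∧
      ∀ j v, G.diff j (f (j + 1) v) = f j (F.diff j v) := by
  refine (exists_seq_of_step
    (X := fun j => (Fin (F.rank j) → MvPolynomial σ K) →ₗ[MvPolynomial σ K]
        (Fin (G.rank j) → MvPolynomial σ K))
    -- The invariant carries, besides gradedness, that `f` sends boundaries to boundaries; this is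
    -- what allows the next lift.
    (fun j f => (∀ e, ∀ v ∈ twistedPart (F.shift j) e, f v ∈ twistedPart (G.shift j) e) ∧
      ∀ w, f (F.diff j w) ∈ LinearMap.range (G.diff j))
    (fun j f f' => ∀ v, G.diff j (f' v) = f (F.diff j v))
    (fun f => ∀ v, G.aug (f v) = F.aug v) ?_ ?_).imp fun f hf => ⟨hf.1, fun j => (hf.2.1 j).1, hf.2.2⟩
  · obtain ⟨f, hf, hfD⟩ := exists_graded_map_lift (b := F.shift 0) (c := G.shift 0) G.aug F.aug
      (fun i => by
        refine exists_mem_twistedPart_of_aug G.aug G.aug_graded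
          (F.aug_graded _ _ (single_mem_twistedPart _ i)) ?_
        rw [G.range_aug]
        exact hAB (F.range_aug.le (LinearMap.mem_range_self _ _)))
    refine ⟨f, ⟨hf, fun w => (G.exact_aug _).1 ?_⟩, hfD⟩
    rw [hfD, F.aug_diff]
  · rintro j f ⟨hf, hfr⟩
    obtain ⟨f', hf', hfD'⟩ := exists_graded_map_lift (b := F.shift (j + 1))
      (c := G.shift (j + 1)) (G.diff j) (f.comp (F.diff j))
      (fun i => exists_mem_twistedPart_of_diff (G.diff j) (G.diff_graded j)
        (hf _ _ (F.diff_graded j _ _ (single_mem_twistedPart _ i))) (hfr _))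
    refine ⟨f', ⟨hf', fun w => G.diff_mem_range ?_⟩, hfD'⟩
    rw [hfD', LinearMap.comp_apply, F.diff_diff, map_zero]

/-- An endomorphism of a resolution that lifts the identity is homotopic to the identity. -/
theorem exists_homotopy (F : GradedFreeResolution I)
    (u : ∀ j, (Fin (F.rank j) → MvPolynomial σ K) →ₗ[MvPolynomial σ K]
      (Fin (F.rank j) → MvPolynomial σ K))
    (hu0 : ∀ v, F.aug (u 0 v) = F.aug v)
    (hu : ∀ j v, F.diff j (u (j + 1) v) = u j (F.diff j v)) :
    ∃ h : ∀ j, (Fin (F.rank j) → MvPolynomial σ K) →ₗ[MvPolynomial σ K]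
        (Fin (F.rank (j + 1)) → MvPolynomial σ K),
      (∀ v, F.diff 0 (h 0 v) = u 0 v - v) ∧
      ∀ j v, F.diff (j + 1) (h (j + 1) v) = u (j + 1) v - v - h j (F.diff j v) := by
  refine (exists_seq_of_step
    (X := fun j => (Fin (F.rank j) → MvPolynomial σ K) →ₗ[MvPolynomial σ K]
        (Fin (F.rank (j + 1)) → MvPolynomial σ K))
    -- Knowing the homotopy relation on boundaries suffices to put `u - id - h d` into the kernel of
    -- the differential at the next stage. The homotopy need not be graded.
    (fun j h => ∀ w, F.diff j (h (F.diff j w)) = u j (F.diff j w) - F.diff j w)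
    (fun j h h' => ∀ v, F.diff (j + 1) (h' v) = u (j + 1) v - v - h (F.diff j v))
    (fun h => ∀ v, F.diff 0 (h v) = u 0 v - v) ?_ ?_).imp fun h hh => ⟨hh.1, hh.2.2⟩
  · obtain ⟨h, hh⟩ := exists_map_lift (F.diff 0) (u 0 - LinearMap.id) (fun v =>
      (F.exact_aug _).1 (by simp [hu0]))
    exact ⟨h, fun w => hh _, hh⟩
  · intro j h hQ
    obtain ⟨h', hh'⟩ := exists_map_lift (F.diff (j + 1))
      (u (j + 1) - LinearMap.id - h.comp (F.diff j)) (fun v =>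
        F.diff_mem_range (by simp [hu, hQ]))
    exact ⟨h', fun w => by simp [hh', F.diff_diff], hh'⟩

end GradedFreeResolution

theorem map_apply_mem_of_forall_mem {R ι κ : Type*} [CommRing R] [Fintype ι] {J : Ideal R}
    (f : (ι → R) →ₗ[R] (κ → R)) {v : ι → R} (hv : ∀ i, v i ∈ J) (k : κ) : f v k ∈ J := by
  classical
  rw [map_eq_sum_single f v, Finset.sum_apply]
  exact J.sum_mem fun i _ => J.mul_mem_right _ (hv i)

/-- If an ideal has a linear resolution, then each of its minimal graded free resolutions is
linear. -/
theorem GradedFreeResolution.IsMinimal.shift_eq {σ K : Type*} [Field K]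
    {I : Ideal (MvPolynomial σ K)} {F : GradedFreeResolution I} (hF : F.IsMinimal)
    (L : GradedFreeResolution I) {a : ℤ} (hL : ∀ j i, L.shift j i = a + j) (j : ℕ)
    (i : Fin (F.rank j)) : F.shift j i = a + j := by
  obtain ⟨f, hf0, hf, hfd⟩ := F.exists_lift L le_rfl
  obtain ⟨g, hg0, -, hgd⟩ := L.exists_lift F le_rfl
  obtain ⟨h, hh0, hh⟩ := F.exists_homotopy (fun j => (g j).comp (f j))
    (fun v => by simp [hf0, hg0]) (fun j v => by simp [hfd, hgd])
  by_contra hne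
  -- If the shift differs from `a + j`, the entries of `f` at this basis vector have non-zero degree
  -- and so lie in `𝔪`.
  have hu : ∀ i', g j (f j (Pi.single i 1)) i' ∈
      Ideal.span (Set.range (MvPolynomial.X : σ → MvPolynomial σ K)) := by
    refine map_apply_mem_of_forall_mem (g j) fun k => ?_
    refine mem_ideal_vars_of_mem_polyPart ?_
      (mem_twistedPart_iff.1 (hf j _ _ (single_mem_twistedPart _ i)) k)
    rw [hL]
    exact sub_ne_zero.2 hne
  refine one_notMem_ideal_vars (σ := σ) (K := K) ?_
  -- In the homotopy relation at this basis vector, minimality puts the terms `d h` and `h d` in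
  -- `𝔪`; comparing coordinate `i` would give `1 ∈ 𝔪`.
  rcases j with _ | j
  · have h1 := congrFun (hh0 (Pi.single i 1)) i
    have h2 := hF 0 (h 0 (Pi.single i 1)) i
    rw [h1] at h2
    simpa using Ideal.sub_mem _ (hu i) h2
  · have h1 := congrFun (hh j (Pi.single i 1)) i
    have h2 := hF (j + 1) (h (j + 1) (Pi.single i 1)) i
    have h3 := map_apply_mem_of_forall_mem (h j) (hF j (Pi.single i 1)) i
    rw [h1] at h2
    simpa using Ideal.sub_mem _ (hu i) (Ideal.add_mem _ h2 h3)

/-! ### Mapping cones -/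

theorem exists_eq_elim_elim {R α β γ : Type*} (w : α ⊕ β ⊕ γ → R) :
    ∃ u v t, w = Sum.elim u (Sum.elim v t) :=
  ⟨fun i => w (.inl i), fun i => w (.inr (.inl i)), fun i => w (.inr (.inr i)), by
    ext (i | i | i) <;> rfl⟩

theorem elim_elim_eq_iff {R α β γ : Type*} {u u' : α → R} {v v' : β → R} {t t' : γ → R} :
    Sum.elim u (Sum.elim v t) = Sum.elim u' (Sum.elim v' t') ↔ u = u' ∧ v = v' ∧ t = t' := by
  rw [Sum.elim_eq_iff, Sum.elim_eq_iff]

theorem elim_elim_eq_zero_iff {R α β γ : Type*} [Zero R] {u : α → R} {v : β → R} {t : γ → R} :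
    Sum.elim u (Sum.elim v t) = 0 ↔ u = 0 ∧ v = 0 ∧ t = 0 := by
  rw [← elim_elim_eq_iff (R := R)]
  simp only [Sum.elim_zero_zero]

section Cone

variable {R α α' α'' β β' β'' γ : Type*} [CommRing R]

/-- The differential `(u, v, t) ↦ (d u + x t, δ v - φ t, -d' t)` of a mapping cone. -/
def coneMap (d : (α' → R) →ₗ[R] (α → R)) (δ : (β' → R) →ₗ[R] (β → R)) (x : R)
    (φ : (α → R) →ₗ[R] (β → R)) (d' : (α → R) →ₗ[R] (γ → R)) :
    (α' ⊕ β' ⊕ α → R) →ₗ[R] (α ⊕ β ⊕ γ → R) :=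
  (LinearEquiv.sumArrowLequivProdArrow α (β ⊕ γ) R R).symm.toLinearMap.comp <|
    (d.comp (LinearMap.funLeft R R Sum.inl) +
        x • LinearMap.funLeft R R (Sum.inr ∘ Sum.inr)).prod <|
      (LinearEquiv.sumArrowLequivProdArrow β γ R R).symm.toLinearMap.comp <|
        (δ.comp (LinearMap.funLeft R R (Sum.inr ∘ Sum.inl)) -
            φ.comp (LinearMap.funLeft R R (Sum.inr ∘ Sum.inr))).prod
          (-d'.comp (LinearMap.funLeft R R (Sum.inr ∘ Sum.inr)))

/-- The augmentation `(u, v) ↦ a u + x b v` of a mapping cone. -/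
def coneAug (a : (α → R) →ₗ[R] R) (b : (β → R) →ₗ[R] R) (x : R) : (α ⊕ β ⊕ γ → R) →ₗ[R] R :=
  a.comp (LinearMap.funLeft R R Sum.inl) +
    x • b.comp (LinearMap.funLeft R R (Sum.inr ∘ Sum.inl))

theorem coneMap_elim (d : (α' → R) →ₗ[R] (α → R)) (δ : (β' → R) →ₗ[R] (β → R)) (x : R)
    (φ : (α → R) →ₗ[R] (β → R)) (d' : (α → R) →ₗ[R] (γ → R)) (u : α' → R) (v : β' → R)
    (t : α → R) :
    coneMap d δ x φ d' (Sum.elim u (Sum.elim v t)) =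
      Sum.elim (d u + x • t) (Sum.elim (δ v - φ t) (-d' t)) := rfl

theorem coneAug_elim (a : (α → R) →ₗ[R] R) (b : (β → R) →ₗ[R] R) (x : R)
    (u : α → R) (v : β → R) (t : γ → R) :
    coneAug a b x (Sum.elim u (Sum.elim v t)) = a u + x * b v := rfl

/-- For a cycle `(u, v, t)`, saturation of the boundaries under `x` gives `t = d₀ s`. Then `u + x s`
and `v - φ₁ s` are cycles, and their preimages together with `-s` form a preimage of `(u, v, t)`. -/
theorem exact_coneMap {d₁ : (α'' → R) →ₗ[R] (α' → R)} {d₀ : (α' → R) →ₗ[R] (α → R)}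
    {δ₁ : (β'' → R) →ₗ[R] (β' → R)} {δ₀ : (β' → R) →ₗ[R] (β → R)} {x : R}
    {φ₁ : (α' → R) →ₗ[R] (β' → R)} {φ₀ : (α → R) →ₗ[R] (β → R)} {d' : (α → R) →ₗ[R] (γ → R)}
    (hd : Function.Exact d₁ d₀) (hδ : Function.Exact δ₁ δ₀)
    (hφ : ∀ v, δ₀ (φ₁ v) = φ₀ (d₀ v)) (hd' : ∀ v, d' (d₀ v) = 0)
    (hsat : ∀ t, x • t ∈ LinearMap.range d₀ → t ∈ LinearMap.range d₀) :
    Function.Exact (coneMap d₁ δ₁ x φ₁ d₀) (coneMap d₀ δ₀ x φ₀ d') := by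
  intro w
  constructor
  · obtain ⟨u, v, t, rfl⟩ := exists_eq_elim_elim w
    rw [coneMap_elim, elim_elim_eq_zero_iff]
    rintro ⟨h1, h2, -⟩
    obtain ⟨s, hs⟩ := hsat t ⟨-u, by rw [map_neg, neg_eq_iff_add_eq_zero, h1]⟩
    obtain ⟨u', hu'⟩ := (hd (u + x • s)).1 (by rw [map_add, map_smul, hs, h1])
    obtain ⟨v', hv'⟩ := (hδ (v - φ₁ s)).1 (by rw [map_sub, hφ, hs, h2])
    refine ⟨Sum.elim u' (Sum.elim v' (-s)), ?_⟩
    rw [coneMap_elim, elim_elim_eq_iff, hu', hv']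
    simp [hs]
  · rintro ⟨w, rfl⟩
    obtain ⟨u, v, t, rfl⟩ := exists_eq_elim_elim w
    rw [coneMap_elim, coneMap_elim, elim_elim_eq_zero_iff]
    refine ⟨?_, ?_, ?_⟩
    · simp [hd.apply_apply_eq_zero]
    · simp [hδ.apply_apply_eq_zero, hφ]
    · simp [hd']

/-- The same argument at the end of the complex, where `γ` is empty because `F_{-1} = 0`; saturation
of the ideal `range a` replaces that of the boundaries. -/
theorem exact_coneAug [IsEmpty γ] {d₀ : (α' → R) →ₗ[R] (α → R)} {δ₀ : (β' → R) →ₗ[R] (β → R)}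
    {x : R} {φ₀ : (α → R) →ₗ[R] (β → R)} {d' : (α → R) →ₗ[R] (γ → R)}
    {a : (α → R) →ₗ[R] R} {b : (β → R) →ₗ[R] R}
    (hd : Function.Exact d₀ a) (hδ : Function.Exact δ₀ b) (hφ : ∀ v, b (φ₀ v) = a v)
    (hsat : ∀ r, x * r ∈ LinearMap.range a → r ∈ LinearMap.range a) :
    Function.Exact (coneMap d₀ δ₀ x φ₀ d') (coneAug a b x) := by
  intro w
  constructor
  · obtain ⟨u, v, t, rfl⟩ := exists_eq_elim_elim w
    rw [coneAug_elim]
    intro h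
    obtain ⟨s, hs⟩ := hsat (b v) ⟨-u, by rw [map_neg, neg_eq_iff_add_eq_zero, h]⟩
    obtain ⟨u', hu'⟩ := (hd (u + x • s)).1 (by rw [map_add, map_smul, hs, smul_eq_mul, h])
    obtain ⟨v', hv'⟩ := (hδ (v - φ₀ s)).1 (by rw [map_sub, hφ, hs, sub_self])
    refine ⟨Sum.elim u' (Sum.elim v' (-s)), ?_⟩
    rw [coneMap_elim, elim_elim_eq_iff, hu', hv']
    exact ⟨by simp, by simp, Subsingleton.elim _ _⟩
  · rintro ⟨w, rfl⟩
    obtain ⟨u, v, t, rfl⟩ := exists_eq_elim_elim w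
    rw [coneMap_elim, coneAug_elim]
    simp [hd.apply_apply_eq_zero, hδ.apply_apply_eq_zero, hφ]

theorem mem_range_coneAug {a : (α → R) →ₗ[R] R} {b : (β → R) →ₗ[R] R} {x r : R} :
    r ∈ LinearMap.range (coneAug (γ := γ) a b x) ↔
      ∃ p ∈ LinearMap.range a, ∃ q ∈ LinearMap.range b, r = p + x * q := by
  constructor
  · rintro ⟨w, rfl⟩
    obtain ⟨u, v, t, rfl⟩ := exists_eq_elim_elim w
    exact ⟨_, ⟨u, rfl⟩, _, ⟨v, rfl⟩, rfl⟩
  · rintro ⟨_, ⟨u, rfl⟩, _, ⟨v, rfl⟩, rfl⟩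
    exact ⟨Sum.elim u (Sum.elim v 0), rfl⟩

end Cone

/-! ### Linear resolutions -/

/-- The ideal has a finite graded free resolution whose `j`-th module is generated in degree
`a + j`. -/
def HasLinearFreeResolution {σ K : Type*} [Field K] (I : Ideal (MvPolynomial σ K)) (a : ℤ) : Prop :=
  ∃ L : GradedFreeResolution I, ∀ j i, L.shift j i = a + j

section Linear

variable {σ K : Type*} [Field K]

/-- A linear resolution may be given with arbitrary finite index types for the bases. -/
theorem HasLinearFreeResolution.of_indexed {I : Ideal (MvPolynomial σ K)} {a : ℤ}
    (ι : ℕ → Type) [∀ j, Fintype (ι j)] (hι : ∃ t : ℕ, ∀ j, t < j → IsEmpty (ι j))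
    (D : ∀ j, (ι (j + 1) → MvPolynomial σ K) →ₗ[MvPolynomial σ K] (ι j → MvPolynomial σ K))
    (α : (ι 0 → MvPolynomial σ K) →ₗ[MvPolynomial σ K] MvPolynomial σ K)
    (hD : ∀ (j : ℕ) (e : ℤ) v, (∀ i, v i ∈ polyPart σ K (e - (a + (j + 1 : ℕ)))) →
      ∀ i, D j v i ∈ polyPart σ K (e - (a + j)))
    (hα : ∀ (e : ℤ) v, (∀ i, v i ∈ polyPart σ K (e - a)) → α v ∈ polyPart σ K e)
    (hr : ∀ p, p ∈ LinearMap.range α ↔ p ∈ I)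
    (h0 : Function.Exact (D 0) α) (h1 : ∀ j, Function.Exact (D (j + 1)) (D j)) :
    HasLinearFreeResolution I a := by
  let E : ∀ j, (Fin (Fintype.card (ι j)) → MvPolynomial σ K) ≃ₗ[MvPolynomial σ K]
      (ι j → MvPolynomial σ K) := fun j =>
    LinearEquiv.funCongrLeft _ _ (Fintype.equivFin (ι j))
  refine ⟨{
    rank := fun j => Fintype.card (ι j)
    shift := fun j _ => a + j
    diff := fun j => (E j).symm.toLinearMap.comp ((D j).comp (E (j + 1)).toLinearMap)
    aug := α.comp (E 0).toLinearMap
    finite_length := hι.imp fun t ht j hj => Fintype.card_eq_zero_iff.2 (ht j hj)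
    diff_graded := ?_
    aug_graded := ?_
    range_aug := ?_
    exact_aug := ?_
    exact_diff := ?_ }, fun j i => rfl⟩
  · intro j e v hv
    rw [mem_twistedPart_iff] at hv ⊢
    intro i
    exact hD j e _ (fun i => hv _) _
  · intro e v hv
    rw [mem_twistedPart_iff] at hv
    refine hα e _ fun i => ?_
    have := hv (Fintype.equivFin (ι 0) i)
    rwa [Nat.cast_zero, add_zero] at this
  · ext p
    rw [LinearMap.range_comp_of_range_eq_top _ (E 0).range]
    exact hr p
  · intro v
    constructor
    · intro hv
      obtain ⟨w, hw⟩ := (h0 _).1 hv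
      exact ⟨(E 1).symm w, by simp [hw]⟩
    · rintro ⟨w, rfl⟩
      simp [h0.apply_apply_eq_zero]
  · intro j v
    constructor
    · intro hv
      obtain ⟨w, hw⟩ := (h1 j (E (j + 1) v)).1 (by simpa using hv)
      exact ⟨(E (j + 2)).symm w, by simp [hw]⟩
    · rintro ⟨w, rfl⟩
      simp [(h1 j).apply_apply_eq_zero]

theorem hasLinearFreeResolution_bot (a : ℤ) :
    HasLinearFreeResolution (⊥ : Ideal (MvPolynomial σ K)) a :=
  .of_indexed (fun _ => Empty) ⟨0, fun _ _ => inferInstance⟩ (fun _ => 0) 0 (fun _ _ _ _ i => i.elim)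
    (fun _ _ _ => Submodule.zero_mem _) (fun p => by simp)
    (fun v => by simp [Subsingleton.elim v 0]) (fun j v => by simp [Subsingleton.elim v 0])

theorem hasLinearFreeResolution_top :
    HasLinearFreeResolution (⊤ : Ideal (MvPolynomial σ K)) 0 := by
  have hempty : ∀ j : ℕ, IsEmpty (Fin (1 - (j + 1))) := fun j => by
    rw [Nat.sub_eq_zero_of_le (by omega)]
    infer_instance
  -- Truncated subtraction gives one basis element for `j = 0` and none afterwards.
  refine .of_indexed (fun j => Fin (1 - j)) ⟨0, ?_⟩ (fun _ => 0) (LinearMap.proj (0 : Fin 1))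
    (fun _ _ _ _ _ => Submodule.zero_mem _) (fun e v hv => ?_) (fun p => ?_) (fun v => ?_)
    (fun j v => ?_)
  · rintro (_ | j) hj
    · omega
    · exact hempty j
  · simpa using hv (0 : Fin 1)
  · exact ⟨fun _ => trivial, fun _ => ⟨fun _ => p, rfl⟩⟩
  · constructor
    · intro hv
      refine ⟨0, ?_⟩
      ext1 i
      rw [Subsingleton.elim (α := Fin 1) i 0]
      exact hv.symm
    · rintro ⟨w, rfl⟩
      rfl
  · have := hempty j
    exact ⟨fun _ => ⟨0, Subsingleton.elim _ _⟩, fun _ => rfl⟩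

theorem mem_polyPart_of_eq {e e' : ℤ} {p : MvPolynomial σ K} (hp : p ∈ polyPart σ K e)
    (h : e = e') : p ∈ polyPart σ K e' :=
  h ▸ hp

/-- The ranks of a sequence of free modules shifted by one place. -/
def shiftRank (r : ℕ → ℕ) : ℕ → ℕ
  | 0 => 0
  | j + 1 => r j

/-- The differential `F_j → F_{j-1}`, where `F_{-1} = 0`. -/
noncomputable def GradedFreeResolution.prevDiff {I : Ideal (MvPolynomial σ K)}
    (F : GradedFreeResolution I) : ∀ j, (Fin (F.rank j) → MvPolynomial σ K) →ₗ[MvPolynomial σ K]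
      (Fin (shiftRank F.rank j) → MvPolynomial σ K)
  | 0 => 0
  | j + 1 => F.diff j

/-- Since `x p ∈ A` forces `p ∈ A`, the sequence `0 → A(-1) → A ⊕ B(-1) → I → 0` with first map `s ↦
(x s, -s)` is exact. In its mapping cone `F_j`, `G_j(-1)` and `F_{j-1}(-1)` are all generated in
degree `a + 1 + j`. -/
theorem HasLinearFreeResolution.add_mul {A B I : Ideal (MvPolynomial σ K)} {a : ℤ}
    (hA : HasLinearFreeResolution A (a + 1)) (hB : HasLinearFreeResolution B a) (hAB : A ≤ B)
    {x : MvPolynomial σ K} (hx : x ∈ polyPart σ K 1) (hx0 : x ≠ 0)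
    (hsat : ∀ p, x * p ∈ A → p ∈ A)
    (hI : ∀ p, p ∈ I ↔ ∃ q ∈ A, ∃ r ∈ B, p = q + x * r) : HasLinearFreeResolution I (a + 1) := by
  obtain ⟨F, hF⟩ := hA
  obtain ⟨G, hG⟩ := hB
  obtain ⟨φ, hφ0, hφ, hφd⟩ := F.exists_lift G hAB
  -- Boundaries are the kernel of a map into a free module over a domain, so the non-zero factor `x`
  -- cancels.
  have hsatF : ∀ j t, x • t ∈ LinearMap.range (F.diff j) → t ∈ LinearMap.range (F.diff j) := by
    rintro (_ | j) t ⟨s, hs⟩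
    · refine (F.exact_aug t).1 ((smul_eq_zero_iff_right hx0).1 ?_)
      rw [← map_smul, ← hs, F.aug_diff]
    · refine F.diff_mem_range ((smul_eq_zero_iff_right hx0).1 ?_)
      rw [← map_smul, ← hs, F.diff_diff]
  have hprev : ∀ j v, F.prevDiff j (F.diff j v) = 0 := by
    rintro (_ | j) v
    · rfl
    · exact F.diff_diff j v
  refine .of_indexed (fun j => Fin (F.rank j) ⊕ Fin (G.rank j) ⊕ Fin (shiftRank F.rank j)) ?_
    (fun j => coneMap (F.diff j) (G.diff j) x (φ j) (F.prevDiff j)) (coneAug F.aug G.aug x)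
    ?_ ?_ ?_ ?_ ?_
  · obtain ⟨s, hs⟩ := F.finite_length
    obtain ⟨t, ht⟩ := G.finite_length
    refine ⟨s + t + 1, ?_⟩
    rintro (_ | j) hj
    · omega
    · have h1 := hs (j + 1) (by omega)
      have h2 := ht (j + 1) (by omega)
      have h3 : shiftRank F.rank (j + 1) = 0 := hs j (by omega)
      rw [h1, h2, h3]
      infer_instance
  · intro j e w
    obtain ⟨u, v, t, rfl⟩ := exists_eq_elim_elim w
    intro hw
    have hu : u ∈ twistedPart (F.shift (j + 1)) e := mem_twistedPart_iff.2 fun i =>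
      mem_polyPart_of_eq (hw (.inl i)) (by rw [hF])
    have hv : v ∈ twistedPart (G.shift (j + 1)) (e - 1) := mem_twistedPart_iff.2 fun i =>
      mem_polyPart_of_eq (hw (.inr (.inl i))) (by rw [hG]; ring)
    have ht : t ∈ twistedPart (F.shift j) (e - 1) := mem_twistedPart_iff.2 fun i =>
      mem_polyPart_of_eq (hw (.inr (.inr i))) (by rw [hF]; push_cast; ring)
    have hdu := mem_twistedPart_iff.1 (F.diff_graded _ _ _ hu)
    have hdv := mem_twistedPart_iff.1 (G.diff_graded _ _ _ hv)
    have hft := mem_twistedPart_iff.1 (hφ _ _ _ ht)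
    rintro (i | i | i)
    · refine Submodule.add_mem _ (mem_polyPart_of_eq (hdu i) (by rw [hF])) ?_
      exact mem_polyPart_of_eq (mul_mem_polyPart hx (mem_twistedPart_iff.1 ht i))
        (by rw [hF]; ring)
    · exact Submodule.sub_mem _ (mem_polyPart_of_eq (hdv i) (by rw [hG]; ring))
        (mem_polyPart_of_eq (hft i) (by rw [hG]; ring))
    · rcases j with _ | j
      · exact i.elim0
      · exact Submodule.neg_mem _ (mem_polyPart_of_eq
          (mem_twistedPart_iff.1 (F.diff_graded _ _ _ ht) i)
          (by have h := hF j i; rw [Nat.cast_succ]; linarith))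
  · intro e w
    obtain ⟨u, v, t, rfl⟩ := exists_eq_elim_elim w
    intro hw
    rw [coneAug_elim]
    refine Submodule.add_mem _ (F.aug_graded _ _ (mem_twistedPart_iff.2 fun i => ?_)) ?_
    · exact mem_polyPart_of_eq (hw (.inl i)) (by rw [hF]; simp)
    · refine mem_polyPart_of_eq (mul_mem_polyPart hx (G.aug_graded (e - 1) v
        (mem_twistedPart_iff.2 fun i => ?_))) (by ring)
      exact mem_polyPart_of_eq (hw (.inr (.inl i))) (by rw [hG]; push_cast; ring)
  · intro p
    rw [mem_range_coneAug, hI, F.range_aug, G.range_aug]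
  · have : IsEmpty (Fin (shiftRank F.rank 0)) := inferInstanceAs (IsEmpty (Fin 0))
    exact exact_coneAug F.exact_aug G.exact_aug hφ0
      fun r hr => F.range_aug.ge (hsat r (F.range_aug.le hr))
  · intro j
    exact exact_coneMap (F.exact_diff j) (G.exact_diff j) (hφd j) (hprev j) (hsatF j)

end Linear


/-! ### Monomial ideals with linear resolutions -/

section Monomial

variable {σ K : Type*} [Field K]

open MvPolynomial in
theorem mem_restrictSupportIdeal_iff {U : Set (σ →₀ ℕ)} (hU : IsUpperSet U)
    {p : MvPolynomial σ K} :
    p ∈ restrictSupportIdeal (R := K) U hU ↔ ∀ u, p.coeff u ≠ 0 → u ∈ U := by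
  change (p.support : Set (σ →₀ ℕ)) ⊆ U ↔ _
  simp [Set.subset_def]

theorem X_mem_polyPart (i : σ) : (MvPolynomial.X i : MvPolynomial σ K) ∈ polyPart σ K 1 := by
  simpa using mem_polyPart_natCast.2 (MvPolynomial.isHomogeneous_X K i)

open MvPolynomial in
/-- Linear resolutions for a monomial ideal `A + X i * B`. -/
theorem HasLinearFreeResolution.restrictSupport_step {U V W : Set (σ →₀ ℕ)}
    (hU : IsUpperSet U) (hV : IsUpperSet V) (hW : IsUpperSet W) (i : σ) {a : ℤ}
    (hLU : HasLinearFreeResolution (restrictSupportIdeal (R := K) U hU) (a + 1))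
    (hLV : HasLinearFreeResolution (restrictSupportIdeal (R := K) V hV) a)
    (hUV : U ⊆ V) (hUsat : ∀ u, u + Finsupp.single i 1 ∈ U → u ∈ U) (hUW : U ⊆ W)
    (hWU : ∀ u ∈ W, u i = 0 → u ∈ U) (hWV : ∀ u, u + Finsupp.single i 1 ∈ W ↔ u ∈ V) :
    HasLinearFreeResolution (restrictSupportIdeal (R := K) W hW) (a + 1) := by
  refine hLU.add_mul hLV (fun p hp => ?_) (X_mem_polyPart i) (X_ne_zero i) (fun p hp => ?_)
    fun p => ⟨fun hp => ?_, ?_⟩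
  · rw [mem_restrictSupportIdeal_iff] at hp ⊢
    exact fun u hu => hUV (hp u hu)
  · rw [mem_restrictSupportIdeal_iff] at hp ⊢
    refine fun u hu => hUsat u (hp _ ?_)
    rwa [add_comm, coeff_X_mul]
  · rw [mem_restrictSupportIdeal_iff] at hp
    -- Division by `X i`: the remainder involves only monomials free of `X i`, which `hWU` puts in
    -- `U`.
    refine ⟨p.modMonomial (Finsupp.single i 1), ?_, p.divMonomial (Finsupp.single i 1), ?_,
      (modMonomial_add_divMonomial_single p i).symm⟩
    · rw [mem_restrictSupportIdeal_iff]
      intro u hu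
      by_cases hi : Finsupp.single i 1 ≤ u
      · exact absurd (coeff_modMonomial_of_le p hi) hu
      · rw [coeff_modMonomial_of_not_le p hi] at hu
        refine hWU u (hp u hu) ?_
        by_contra h
        exact hi (Finsupp.single_le_iff.2 (Nat.one_le_iff_ne_zero.2 h))
    · rw [mem_restrictSupportIdeal_iff]
      intro u hu
      rw [coeff_divMonomial, add_comm] at hu
      exact (hWV u).1 (hp _ hu)
  · rintro ⟨q, hq, r, hr, rfl⟩
    rw [mem_restrictSupportIdeal_iff] at hq hr
    refine Ideal.add_mem _ ((mem_restrictSupportIdeal_iff hW).2 fun u hu => hUW (hq u hu)) ?_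
    rw [mem_restrictSupportIdeal_iff]
    intro u hu
    classical
    rw [coeff_X_mul'] at hu
    split_ifs at hu with hi
    · have h := (hWV _).2 (hr _ hu)
      rwa [tsub_add_cancel_of_le] at h
      exact Finsupp.single_le_iff.2 (Nat.one_le_iff_ne_zero.2 (Finsupp.mem_support_iff.1 hi))
    · exact absurd rfl hu

/-- The exponents of total degree at least `a` in the variables from `s`. -/
def degSet (s : Finset σ) (a : ℕ) : Set (σ →₀ ℕ) := {u | a ≤ ∑ i ∈ s, u i}

theorem isUpperSet_degSet (s : Finset σ) (a : ℕ) : IsUpperSet (degSet s a) :=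
  fun _ _ huv hu => le_trans hu (Finset.sum_le_sum fun i _ => huv i)

theorem sum_add_single_of_mem {s : Finset σ} {i : σ} (hi : i ∈ s) (u : σ →₀ ℕ) :
    ∑ j ∈ s, (u + Finsupp.single i 1 : σ →₀ ℕ) j = ∑ j ∈ s, u j + 1 := by
  classical
  simp [Finsupp.single_apply, Finset.sum_add_distrib, hi]

theorem sum_add_single_of_notMem {s : Finset σ} {i : σ} (hi : i ∉ s) (u : σ →₀ ℕ) :
    ∑ j ∈ s, (u + Finsupp.single i 1 : σ →₀ ℕ) j = ∑ j ∈ s, u j := by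
  classical
  simp [Finsupp.single_apply, Finset.sum_add_distrib, hi]

theorem degSet_zero (s : Finset σ) : degSet s 0 = Set.univ := by
  simp [degSet]

/-- Powers of an ideal generated by variables have linear resolutions. -/
theorem hasLinearFreeResolution_degSet (s : Finset σ) (a : ℕ) :
    HasLinearFreeResolution
      (MvPolynomial.restrictSupportIdeal (R := K) (degSet s a) (isUpperSet_degSet s a)) a := by
  classical
  have hzero : ∀ s : Finset σ, HasLinearFreeResolution
      (MvPolynomial.restrictSupportIdeal (R := K) (degSet s 0) (isUpperSet_degSet s 0))
        (0 : ℕ) := by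
    intro s
    convert hasLinearFreeResolution_top (σ := σ) (K := K)
    swap
    · exact Nat.cast_zero
    rw [eq_top_iff]
    intro p _
    simp [mem_restrictSupportIdeal_iff, degSet_zero]
  induction s using Finset.induction_on generalizing a with
  | empty =>
    rcases a with _ | a
    · exact hzero _
    · convert hasLinearFreeResolution_bot (σ := σ) (K := K) _
      rw [eq_bot_iff]
      intro p hp
      rw [mem_restrictSupportIdeal_iff] at hp
      ext u
      by_contra hu
      simpa [degSet] using hp u hu
  | insert i s hi ih =>
    induction a with
    | zero => exact hzero _
    | succ a iha =>
      rw [Nat.cast_succ]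
      -- With `P_s` generated by the variables of `s`: `P_{s ∪ i} ^ (a + 1) = P_s ^ (a + 1) + X_i *
      -- P_{s ∪ i} ^ a`.
      refine .restrictSupport_step (isUpperSet_degSet s (a + 1)) (isUpperSet_degSet (insert i s) a)
        _ i (by exact_mod_cast ih (a + 1)) iha ?_ ?_ ?_ ?_ ?_
      · intro u hu
        simp only [degSet, Set.mem_ofPred_eq, Finset.sum_insert hi] at hu ⊢
        omega
      · intro u hu
        simpa only [degSet, Set.mem_ofPred_eq, sum_add_single_of_notMem hi] using hu
      · intro u hu
        simp only [degSet, Set.mem_ofPred_eq, Finset.sum_insert hi] at hu ⊢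
        omega
      · intro u hu hui
        simpa only [degSet, Set.mem_ofPred_eq, Finset.sum_insert hi, hui, zero_add] using hu
      · intro u
        simp only [degSet, Set.mem_ofPred_eq, sum_add_single_of_mem (Finset.mem_insert_self i s)]
        omega

/-- The exponents of the monomials in `P * 𝔪 ^ m`, where `P` is generated by the variables from `s`
and `𝔪` by `X t` and the variables from `s`. -/
def truncSet (s : Finset σ) (t : σ) (m : ℕ) : Set (σ →₀ ℕ) :=
  {u | 1 ≤ ∑ i ∈ s, u i ∧ m + 1 ≤ ∑ i ∈ s, u i + u t}

theorem isUpperSet_truncSet (s : Finset σ) (t : σ) (m : ℕ) : IsUpperSet (truncSet s t m) := by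
  intro u v huv hu
  have h : ∑ i ∈ s, u i ≤ ∑ i ∈ s, v i := Finset.sum_le_sum fun i _ => huv i
  have ht := huv t
  simp only [truncSet, Set.mem_ofPred_eq] at hu ⊢
  omega

/-- Induction through `P * 𝔪 ^ (m + 1) = P ^ (m + 2) + X_t * (P * 𝔪 ^ m)`, starting from `P` itself;
`X_t` is a nonzerodivisor modulo `P ^ (m + 2)` because `t ∉ s`. -/
theorem hasLinearFreeResolution_truncSet {s : Finset σ} {t : σ} (ht : t ∉ s) (m : ℕ) :
    HasLinearFreeResolution
      (MvPolynomial.restrictSupportIdeal (R := K) (truncSet s t m) (isUpperSet_truncSet s t m))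
      (m + 1) := by
  induction m with
  | zero =>
    have h : truncSet s t 0 = degSet s 1 := by
      ext u
      simp only [degSet, truncSet, Set.mem_ofPred_eq]
      omega
    have := hasLinearFreeResolution_degSet (K := K) s 1
    simpa [h] using this
  | succ m ih =>
    rw [Nat.cast_succ]
    refine .restrictSupport_step (isUpperSet_degSet s (m + 2)) (isUpperSet_truncSet s t m)
      _ t ?_ ih ?_ ?_ ?_ ?_ ?_
    · have := hasLinearFreeResolution_degSet (K := K) s (m + 2)
      rw [show ((m + 2 : ℕ) : ℤ) = m + 1 + 1 by push_cast; ring] at this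
      exact this
    · intro u hu
      simp only [degSet, truncSet, Set.mem_ofPred_eq] at hu ⊢
      omega
    · intro u hu
      simpa only [degSet, Set.mem_ofPred_eq, sum_add_single_of_notMem ht] using hu
    · intro u hu
      simp only [degSet, truncSet, Set.mem_ofPred_eq] at hu ⊢
      omega
    · intro u hu hut
      simp only [degSet, truncSet, Set.mem_ofPred_eq] at hu ⊢
      omega
    · intro u
      have h : (u + Finsupp.single t 1 : σ →₀ ℕ) t = u t + 1 := by simp
      simp only [truncSet, Set.mem_ofPred_eq, sum_add_single_of_notMem ht, h]
      omega

end Monomial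

/-! ### Regularity from linear resolutions -/

section Regularity

variable {σ K : Type*} [Field K]

/-- Consecutive shifts differ by one, so all matrix entries of the differentials are linear forms.
-/
theorem GradedFreeResolution.isMinimal_of_shift_eq {I : Ideal (MvPolynomial σ K)}
    {L : GradedFreeResolution I} {a : ℤ} (hL : ∀ j i, L.shift j i = a + j) : L.IsMinimal := by
  intro j v i
  rw [map_eq_sum_single (L.diff j) v, Finset.sum_apply]
  refine Ideal.sum_mem _ fun l _ => Ideal.mul_mem_left _ _ ?_
  refine mem_ideal_vars_of_mem_polyPart ?_
    (mem_twistedPart_iff.1 (L.diff_graded j _ _ (single_mem_twistedPart _ l)) i)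
  rw [hL, hL]
  push_cast
  omega

theorem HasLinearFreeResolution.hasLinearResolution {I : Ideal (MvPolynomial σ K)} {a : ℤ}
    (h : HasLinearFreeResolution I a) : HasLinearResolution I a := by
  obtain ⟨L, hL⟩ := h
  exact ⟨L, GradedFreeResolution.isMinimal_of_shift_eq hL, hL⟩

theorem HasLinearFreeResolution.hasRegularity {I : Ideal (MvPolynomial σ K)} {a : ℤ}
    (h : HasLinearFreeResolution I a) (hI : I ≠ ⊥) : HasRegularity I a := by
  obtain ⟨L, hL⟩ := h
  refine ⟨⟨L, GradedFreeResolution.isMinimal_of_shift_eq hL⟩, fun F hF => ?_⟩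
  have hshift := hF.shift_eq L hL
  constructor
  · have h0 : F.rank 0 ≠ 0 := by
      intro h0
      refine hI ?_
      have : IsEmpty (Fin (F.rank 0)) := by rw [h0]; infer_instance
      rw [← F.range_aug, LinearMap.range_eq_bot]
      exact LinearMap.ext fun v => by rw [Subsingleton.elim v 0, map_zero, map_zero]
    exact ⟨0, ⟨0, Nat.pos_of_ne_zero h0⟩, by simp [hshift]⟩
  · rintro x ⟨j, i, rfl⟩
    simp [hshift]

end Regularity

/-! ### Ideals generated by products of linear forms -/

section Products

variable {K : Type*} [Field K]

/-- If no non-zero combination of the rows of `A` is supported in `J`, then the columns of `A`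
outside `J` span. -/
theorem mem_span_cols {ι κ : Type*} [Fintype ι] {A : Matrix ι κ K} {J : Set κ}
    (h : ∀ y : ι → K, (∀ j ∉ J, Matrix.vecMul y A j = 0) → y = 0) (c : ι → K) :
    c ∈ Submodule.span K (A.col '' Jᶜ) := by
  classical
  by_contra hc
  -- A functional that kills the columns outside `J` but not `c` is a non-zero row combination
  -- supported in `J`.
  obtain ⟨f, hfc, hf⟩ := Submodule.exists_le_ker_of_notMem hc
  have key : ∀ v, f v = ∑ i, v i * f (Pi.single i 1) := map_eq_sum_single f
  refine hfc ?_
  have hy := h (fun i => f (Pi.single i 1)) fun j hj => by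
    have h1 : f (A.col j) = 0 := hf (Submodule.subset_span ⟨j, hj, rfl⟩)
    rw [key] at h1
    rw [← h1]
    exact Finset.sum_congr rfl fun i _ => mul_comm _ _
  rw [key]
  exact Finset.sum_eq_zero fun i _ => by rw [show f (Pi.single i 1) = 0 from congrFun hy i, mul_zero]

/-- The columns outside `J` span, so each `b i` is a scalar combination of the given sums. It is
applied to `G^w` with all variables and to `G` with the row variables. -/
theorem mul_mem_of_mul_combination_mem {ι κ σ : Type*} [Fintype ι] {A : Matrix ι κ K} {J : Set κ}
    (h : ∀ y : ι → K, (∀ j ∉ J, Matrix.vecMul y A j = 0) → y = 0)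
    {I : Ideal (MvPolynomial σ K)} {p : MvPolynomial σ K} (b : ι → MvPolynomial σ K)
    (hp : ∀ j ∉ J, p * ∑ i, MvPolynomial.C (A i j) * b i ∈ I) (i : ι) : p * b i ∈ I := by
  classical
  have key : ∀ c ∈ Submodule.span K (A.col '' Jᶜ), p * ∑ i, MvPolynomial.C (c i) * b i ∈ I := by
    intro c hc
    induction hc using Submodule.span_induction with
    | mem c hc =>
      obtain ⟨j, hj, rfl⟩ := hc
      exact hp j hj
    | zero => simp
    | add c c' _ _ hc hc' =>
      simpa [add_mul, Finset.sum_add_distrib, mul_add] using I.add_mem hc hc'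
    | smul r c _ hc =>
      have := I.mul_mem_left (MvPolynomial.C r) hc
      rw [mul_left_comm, Finset.mul_sum] at this
      simpa [mul_assoc] using this
  have := key (Pi.single i 1) (mem_span_cols h _)
  rw [Finset.sum_eq_single i] at this
  · simpa using this
  · intro j _ hj
    simp [hj]
  · simp

theorem isHomogeneous_columnForm {σ : Type*} [Fintype σ] {n : ℕ} (A : Matrix σ (Fin n) K)
    (j : Fin n) : (columnForm A j).IsHomogeneous 1 :=
  MvPolynomial.IsHomogeneous.sum _ _ _ fun i _ => by
    simpa using (MvPolynomial.isHomogeneous_C σ (A i j)).mul (MvPolynomial.isHomogeneous_X K i)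

theorem columnForm_augmentedMatrix {n k : ℕ} (G : Matrix (Fin k) (Fin n) K) (w : Fin n → K)
    (j : Fin n) : columnForm (augmentedMatrix G w) j =
      ∑ i, MvPolynomial.C (G i j) * MvPolynomial.X (Sum.inl i) +
        MvPolynomial.C (w j) * MvPolynomial.X (Sum.inr ()) := by
  simp [columnForm, augmentedMatrix, Fintype.sum_sum_type]

theorem monomial_eq_mul_X {σ : Type*} {u : σ →₀ ℕ} {i : σ} (hi : u i ≠ 0) (c : K) :
    ∃ v : σ →₀ ℕ, v.degree + 1 = u.degree ∧
      MvPolynomial.monomial u c = MvPolynomial.monomial v c * MvPolynomial.X i := by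
  have hle : Finsupp.single i 1 ≤ u := Finsupp.single_le_iff.2 (Nat.one_le_iff_ne_zero.2 hi)
  refine ⟨u - Finsupp.single i 1, ?_, ?_⟩
  · conv_rhs => rw [← tsub_add_cancel_of_le hle]
    simp
  · rw [MvPolynomial.X, MvPolynomial.monomial_mul, tsub_add_cancel_of_le hle, mul_one]

/-- Induction on the number `r` of missing factors: one variable of the monomial is traded for the
forms of the columns outside `J`, and each of these enlarges `J` by one. -/
theorem prod_mul_monomial_mem_productIdeal {σ : Type*} [Fintype σ] {n : ℕ}
    {A : Matrix σ (Fin n) K} {s : ℕ} (T : Set (Fin n))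
    (hA : ∀ J : Finset (Fin n), J.card < s → (∃ j ∈ J, j ∈ T) →
      ∀ y : σ → K, (∀ j ∉ J, Matrix.vecMul y A j = 0) → y = 0)
    (r : ℕ) (J : Finset (Fin n)) (hJ : J.card + r = s) (hJT : ∃ j ∈ J, j ∈ T) (v : σ →₀ ℕ)
    (hv : r ≤ v.degree) (c : K) :
    (∏ j ∈ J, columnForm A j) * MvPolynomial.monomial v c ∈ productIdeal A s := by
  classical
  induction r generalizing J v with
  | zero => exact Ideal.mul_mem_right _ _ (Ideal.subset_span ⟨J, hJ, rfl⟩)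
  | succ r ih =>
    have hv0 : v ≠ 0 := by
      rintro rfl
      simp at hv
    obtain ⟨i, hi⟩ := Finsupp.ne_iff.1 hv0
    obtain ⟨v', hv', hvc⟩ := monomial_eq_mul_X (K := K) hi c
    rw [hvc, ← mul_assoc]
    refine mul_mem_of_mul_combination_mem (J := (J : Set (Fin n)))
      (by simpa using hA J (by omega) hJT) MvPolynomial.X (fun j hj => ?_) i
    rw [Finset.mem_coe] at hj
    have := ih (insert j J) (by rw [Finset.card_insert_of_notMem hj]; omega)
      (hJT.imp fun j' h => ⟨Finset.mem_insert_of_mem h.1, h.2⟩) v' (by omega)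
    rw [Finset.prod_insert hj, mul_assoc, mul_comm] at this
    exact this

/-- The variables attached to the rows of `G` in the augmented matrix. -/
def rowVars (k : ℕ) : Finset (Fin k ⊕ Unit) := Finset.univ.map Function.Embedding.inl

theorem sum_rowVars {k : ℕ} (u : Fin k ⊕ Unit →₀ ℕ) :
    ∑ i ∈ rowVars k, u i = ∑ i, u (Sum.inl i) := by
  simp [rowVars]

theorem sum_rowVars_add {k : ℕ} (u : Fin k ⊕ Unit →₀ ℕ) :
    ∑ i ∈ rowVars k, u i + u (Sum.inr ()) = u.degree := by
  rw [sum_rowVars, Finsupp.degree_eq_sum, Fintype.sum_sum_type]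
  simp

theorem inr_notMem_rowVars {k : ℕ} : Sum.inr () ∉ rowVars k := by
  simp [rowVars]

theorem columnForm_mem_degSet {n k : ℕ} (G : Matrix (Fin k) (Fin n) K) {w : Fin n → K}
    {j : Fin n} (hj : w j = 0) : columnForm (augmentedMatrix G w) j ∈
      MvPolynomial.restrictSupportIdeal (R := K) (degSet (rowVars k) 1)
        (isUpperSet_degSet (rowVars k) 1) := by
  classical
  rw [columnForm_augmentedMatrix, hj, map_zero, zero_mul, add_zero]
  refine Ideal.sum_mem _ fun i _ => Ideal.mul_mem_left _ _ ?_
  rw [mem_restrictSupportIdeal_iff]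
  intro u hu
  rw [MvPolynomial.coeff_X] at hu
  have hu' : Finsupp.single (Sum.inl i) 1 = u := by
    by_contra h
    simp [h] at hu
  change 1 ≤ _
  rw [sum_rowVars, ← hu']
  exact le_trans (by simp) (Finset.single_le_sum
    (f := fun l => Finsupp.single (Sum.inl i : Fin k ⊕ Unit) 1 (Sum.inl l))
    (fun _ _ => Nat.zero_le _) (Finset.mem_univ i))

/-- `hsupp` gives each generator a factor in `P`. For the reverse inclusion, `hG` trades a row
variable for forms `L_j` with `w j = 0`, and `hA` then trades `m` further variables, starting from
`J = {j}`. -/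
theorem productIdeal_augmentedMatrix_eq {n k : ℕ} {G : Matrix (Fin k) (Fin n) K} {w : Fin n → K}
    {m : ℕ} (hsupp : ∀ J : Finset (Fin n), J.card = m + 1 → ∃ j ∈ J, w j = 0)
    (hG : ∀ y : Fin k → K, (∀ j, w j = 0 → Matrix.vecMul y G j = 0) → y = 0)
    (hA : ∀ J : Finset (Fin n), J.card < m + 1 → (∃ j ∈ J, w j = 0) →
      ∀ y, (∀ j ∉ J, Matrix.vecMul y (augmentedMatrix G w) j = 0) → y = 0) :
    productIdeal (augmentedMatrix G w) (m + 1) =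
      MvPolynomial.restrictSupportIdeal (R := K) (truncSet (rowVars k) (Sum.inr ()) m)
        (isUpperSet_truncSet _ _ _) := by
  classical
  apply le_antisymm
  · refine Ideal.span_le.2 ?_
    rintro _ ⟨J, hJ, rfl⟩
    obtain ⟨j₀, hj₀, hw⟩ := hsupp J hJ
    rw [SetLike.mem_coe, mem_restrictSupportIdeal_iff]
    intro u hu
    have h1 := Ideal.mul_mem_right (∏ j ∈ J.erase j₀, columnForm (augmentedMatrix G w) j) _
      (columnForm_mem_degSet G hw)
    rw [Finset.mul_prod_erase _ _ hj₀, mem_restrictSupportIdeal_iff] at h1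
    have h2 := MvPolynomial.IsHomogeneous.prod J (columnForm (augmentedMatrix G w)) (fun _ => 1)
      fun j _ => isHomogeneous_columnForm _ j
    have h3 := mem_polyPart_iff.1 (mem_polyPart_natCast.2 h2) u hu
    rw [Finset.sum_const, smul_eq_mul, mul_one, hJ] at h3
    refine ⟨h1 u hu, ?_⟩
    rw [sum_rowVars_add]
    omega
  · intro p hp
    rw [mem_restrictSupportIdeal_iff] at hp
    rw [← MvPolynomial.support_sum_monomial_coeff p]
    refine Ideal.sum_mem _ fun u hu => ?_
    obtain ⟨h1, h2⟩ := hp u (MvPolynomial.mem_support_iff.1 hu)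
    rw [sum_rowVars_add] at h2
    rw [sum_rowVars] at h1
    obtain ⟨i, -, hi⟩ := Finset.exists_ne_zero_of_sum_ne_zero (Nat.one_le_iff_ne_zero.1 h1)
    obtain ⟨v, hv, hvc⟩ := monomial_eq_mul_X (K := K) hi (p.coeff u)
    rw [hvc]
    refine mul_mem_of_mul_combination_mem (A := G) (J := {j | w j ≠ 0}) (fun y hy => hG y
      fun j hj => hy j (by simpa using hj)) (fun i => MvPolynomial.X (Sum.inl i)) (fun j hj => ?_) i
    have hj' : w j = 0 := by simpa using hj
    have := prod_mul_monomial_mem_productIdeal {j | w j = 0} hA m {j} (by simp [add_comm])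
      ⟨j, by simp, hj'⟩ v (by omega) (p.coeff u)
    rw [Finset.prod_singleton, columnForm_augmentedMatrix, hj', map_zero, zero_mul, add_zero,
      mul_comm] at this
    exact this

theorem restrictSupportIdeal_truncSet_ne_bot {k : ℕ} (hk : 0 < k) (m : ℕ) :
    MvPolynomial.restrictSupportIdeal (R := K) (truncSet (rowVars k) (Sum.inr ()) m)
      (isUpperSet_truncSet _ _ _) ≠ ⊥ := by
  classical
  intro h
  let u : Fin k ⊕ Unit →₀ ℕ := Finsupp.single (Sum.inl ⟨0, hk⟩) (m + 1)
  have hu : MvPolynomial.monomial u (1 : K) ∈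
      MvPolynomial.restrictSupportIdeal (R := K) (truncSet (rowVars k) (Sum.inr ()) m)
        (isUpperSet_truncSet _ _ _) := by
    rw [mem_restrictSupportIdeal_iff]
    intro v hv
    rw [MvPolynomial.coeff_monomial] at hv
    have huv : u = v := by
      by_contra h
      simp [h] at hv
    subst huv
    have h1 := sum_rowVars_add u
    have h2 : u.degree = m + 1 := by simp [u]
    have h3 : u (Sum.inr ()) = 0 := by simp [u]
    change 1 ≤ _ ∧ _ ≤ _
    omega
  rw [h, Submodule.mem_bot, MvPolynomial.monomial_eq_zero] at hu
  exact one_ne_zero hu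

end Products

/-! ### Consequences of the minimum distance -/

section Code

variable {K : Type*} [Field K] {n k : ℕ} {C : Submodule K (Fin n → K)}
  {G : Matrix (Fin k) (Fin n) K}

theorem IsGeneratingMatrix.vecMul_mem (hG : IsGeneratingMatrix G C) (y : Fin k → K) :
    Matrix.vecMul y G ∈ C := by
  rw [Matrix.vecMul_eq_sum, ← hG.span_eq]
  exact Submodule.sum_mem _ fun i _ => Submodule.smul_mem _ _ (Submodule.subset_span ⟨i, rfl⟩)

theorem IsGeneratingMatrix.eq_zero_of_vecMul_eq_zero (hG : IsGeneratingMatrix G C)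
    {y : Fin k → K} (hy : Matrix.vecMul y G = 0) : y = 0 :=
  Matrix.vecMul_injective_iff.2 hG.linearIndependent (by simpa using hy)

theorem vecMul_augmentedMatrix (w : Fin n → K) (y : Fin k ⊕ Unit → K) (j : Fin n) :
    Matrix.vecMul y (augmentedMatrix G w) j =
      Matrix.vecMul (fun i => y (Sum.inl i)) G j + y (Sum.inr ()) * w j := by
  simp [Matrix.vecMul, dotProduct, augmentedMatrix, Fintype.sum_sum_type]

variable [DecidableEq K] {d : ℕ}

theorem IsLinearCode.le_hammingNorm (hC : IsLinearCode n k d C) {c : Fin n → K} (hc : c ∈ C)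
    (h0 : c ≠ 0) : d ≤ hammingNorm c :=
  hC.isLeast_weight.2 ⟨c, hc, h0, rfl⟩

theorem IsLinearCode.eq_zero_of_support_subset (hC : IsLinearCode n k d C)
    (hG : IsGeneratingMatrix G C) {y : Fin k → K} {J : Finset (Fin n)} (hJ : J.card < d)
    (hy : ∀ j ∉ J, Matrix.vecMul y G j = 0) : y = 0 := by
  refine hG.eq_zero_of_vecMul_eq_zero ?_
  by_contra h0
  have h1 := hC.le_hammingNorm (hG.vecMul_mem y) h0
  have h2 : hammingNorm (Matrix.vecMul y G) ≤ J.card := by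
    refine Finset.card_le_card fun j hj => ?_
    by_contra hjJ
    exact (Finset.mem_filter.1 hj).2 (hy j hjJ)
  omega

/-- The `G`-part of the combination is a codeword supported in `J` together with the support of `w`,
at most `2 * m < d` positions, so it vanishes. What remains is a multiple of `w`. -/
theorem IsLinearCode.eq_zero_of_augmented_support_subset (hC : IsLinearCode n k d C)
    (hG : IsGeneratingMatrix G C) {w : Fin n → K} {m : ℕ} (hw : hammingNorm w = m)
    (hmd : 2 * m < d) {J : Finset (Fin n)} (hJ : J.card < m + 1) (hJw : ∃ j ∈ J, w j = 0)
    {y : Fin k ⊕ Unit → K} (hy : ∀ j ∉ J, Matrix.vecMul y (augmentedMatrix G w) j = 0) :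
    y = 0 := by
  classical
  have hw' : (Finset.univ.filter fun j => w j ≠ 0).card = m := hw
  simp only [vecMul_augmentedMatrix] at hy
  have hinl : (fun i => y (Sum.inl i)) = 0 := by
    refine hC.eq_zero_of_support_subset hG (J := J ∪ Finset.univ.filter fun j => w j ≠ 0)
      (lt_of_le_of_lt (Finset.card_union_le _ _) (by omega)) fun j hj => ?_
    simp only [Finset.mem_union, Finset.mem_filter, Finset.mem_univ, true_and, not_or,
      not_not] at hj
    simpa [hj.2] using hy j hj.1
  have hinr : y (Sum.inr ()) = 0 := by
    by_contra h0
    obtain ⟨j₀, hj₀, hwj⟩ := hJw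
    -- A non-zero multiple of `w` supported in `J` would put the `m` positions of the support of `w`
    -- into `J.erase j₀`, which has at most `m - 1` elements.
    have hsub : (Finset.univ.filter fun j => w j ≠ 0) ⊆ J.erase j₀ := by
      intro j hj
      have hj' := (Finset.mem_filter.1 hj).2
      refine Finset.mem_erase.2 ⟨fun h => hj' (h ▸ hwj), ?_⟩
      by_contra hjJ
      have := hy j hjJ
      rw [hinl, Matrix.zero_vecMul, Pi.zero_apply, zero_add] at this
      exact (mul_ne_zero h0 hj') this
    have h1 := Finset.card_le_card hsub
    rw [Finset.card_erase_of_mem hj₀] at h1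
    have h2 := Finset.card_pos.2 ⟨j₀, hj₀⟩
    omega
  ext (i | i)
  · exact congrFun hinl i
  · exact hinr

theorem IsLinearCode.dim_pos (hC : IsLinearCode n k d C) : 0 < k := by
  obtain ⟨c, hc, h0, -⟩ := hC.isLeast_weight.1
  rw [← hC.finrank_eq, Module.finrank_pos_iff_exists_ne_zero]
  exact ⟨⟨c, hc⟩, by simpa [Subtype.ext_iff] using h0⟩

end Code

theorem theorem3p1 {K : Type*} [Field K] [DecidableEq K] (n k d : ℕ)
    (C : Submodule K (Fin n → K)) (hC : IsLinearCode n k d C) (hd : 3 ≤ d)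
    (G : Matrix (Fin k) (Fin n) K) (hG : IsGeneratingMatrix G C)
    (w : Fin n → K) (m : ℕ) (hw : hammingNorm w = m) (hm : 1 ≤ m) (hmd : m ≤ (d - 1) / 2) :
    HasRegularity (productIdeal (augmentedMatrix G w) (m + 1)) ((m : ℤ) + 1) ∧
      HasLinearResolution (productIdeal (augmentedMatrix G w) (m + 1)) ((m : ℤ) + 1) := by
  have hw' : (Finset.univ.filter fun j => w j ≠ 0).card = m := hw
  have hlin := hasLinearFreeResolution_truncSet (K := K) (inr_notMem_rowVars (k := k)) m
  have hne := restrictSupportIdeal_truncSet_ne_bot (K := K) hC.dim_pos m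
  have heq := productIdeal_augmentedMatrix_eq (G := G) (w := w) (m := m)
    -- The three inputs hold because `m + 1` positions cannot all lie in the support of `w`, because
    -- `m < d`, and because `2 * m < d`.
    (fun J hJ => by
      by_contra! h
      have := Finset.card_le_card fun j hj => Finset.mem_filter.2 ⟨Finset.mem_univ j, h j hj⟩
      omega)
    (fun y hy => hC.eq_zero_of_support_subset hG (J := Finset.univ.filter fun j => w j ≠ 0)
      (by omega) fun j hj => hy j (by simpa using hj))
    (fun J hJ hJw y hy => hC.eq_zero_of_augmented_support_subset hG hw (by omega) hJ hJw hy)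
  rw [heq]
  exact ⟨hlin.hasRegularity hne, hlin.hasLinearResolution⟩
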